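/- **Theorem (haircut process: piecewise law).** Let $\lambda>0$, $r>0$. A *growing process* with growth rate $r$ and renewal rate $\lambda$ is $G_t=rZ_t$, $t\ge 0$, where $Z_t=\inf\{t-Y_n : n\in\mathbb N_0,\ t-Y_n\ge 0\}$, $Y_n=\sum_{j=1}^n X_j$, and $X_1,X_2,\dots$ are positive i.i.d. $\mathrm{Exp}(\lambda)$ random variables (the inter-renewal times). The growing process *started at* $\alpha\ge0$ is $G^{\alpha}_t=G_{\tau_\alpha+t}$, where $\tau_\alpha=\inf\{t\ge0: G_t=\alpha\}$. A *haircut* $(\ell,s)$ with cutoff length $\ell\ge0$ and time $s\ge0$ acts on a process $(K_t)_{t\ge0}$ by $$(\ell,s).K_t=\begin{cases}K_t, & t<s,\\ W_{t-s}^{\min\{K_s,\ell\}}, & t\ge s,\end{cases}$$ where $W$ is a growing process with growth rate $r$ and renewal rate $\lambda$ whose inter-renewal times are independent of $(K_t)_{t\le s}$; a sequence of haircuts acts successively, each with its own such $W$. Let $(G_t)_{t\ge0}$ be a growing process with growth rate $r$ and renewal rate $\lambda$. Let $\ell,s\ge 0$ with $rs\ge\ell$ and let $i>0$. Let $(H_t)_{t\ge0}$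 be the haircut process obtained by letting the haircuts $(\ell,s+ni)$, $n=0,1,2,\dots$, act successively on $G$. Then for every $n\in\mathbb N_0$ $$(H_t)_{t\in[s+ni,\,s+(n+1)i)}\ \sim\ (G_t)_{t\in[\frac{\ell}{r},\,\frac{\ell}{r}+i)},$$ that is, the processes $(H_{s+ni+u})_{0\le u<i}$ and $(G_{\ell/r+u})_{0\le u<i}$ have the same law on $\mathbb R^{[0,i)}$ with the product $\sigma$-algebra (the same joint finite-dimensional distributions). -/

import Mathlib

open MeasureTheory ProbabilityTheory Filter
open scoped NNReal

/-- `X 0, X 1, …` are almost surely positive, independent random variables on `(Ω, P)` with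
common law `ν`: a sequence of inter-renewal times. -/
structure IsInterRenewal {Ω : Type*} [MeasurableSpace Ω] (X : ℕ → Ω → ℝ) (ν : Measure ℝ)
    (P : Measure Ω) : Prop where
  measurable : ∀ j, Measurable (X j)
  pos : ∀ j, ∀ᵐ ω ∂P, 0 < X j ω
  law : ∀ j, P.map (X j) = ν
  indep : iIndepFun X P

/-- The renewal times: the `n`-th one is the sum of the first `n` inter-renewal times, and
the zeroth one is `0`. -/
def renewalTime {Ω : Type*} (X : ℕ → Ω → ℝ) (n : ℕ) (ω : Ω) : ℝ :=
  ∑ j ∈ Finset.range n, X j ω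

/-- The timing process with inter-renewal times `X`: at time `t` it is the infimum of the
nonnegative ones among the numbers `t - Y n`, where `Y n` are the renewal times. -/
noncomputable def timingProcess {Ω : Type*} (X : ℕ → Ω → ℝ) (t : ℝ≥0) (ω : Ω) : ℝ :=
  sInf {z : ℝ | ∃ n : ℕ, z = (t : ℝ) - renewalTime X n ω ∧ 0 ≤ z}

/-- `G` is the growing process with growth rate `r`, renewal rate `lam` and inter-renewal
times `X`, i.e. `G t = r Z t` where `Z` is the timing process induced by the i.i.d.
exponential times `X` of rate `lam`. -/
structure IsGrowingProcess {Ω : Type*} [MeasurableSpace Ω] (r : ℝ≥0) (lam : ℝ)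
    (X : ℕ → Ω → ℝ) (G : ℝ≥0 → Ω → ℝ) (P : Measure Ω) : Prop where
  interRenewal : IsInterRenewal X (expMeasure lam) P
  eq_scaled : ∀ t ω, G t ω = (r : ℝ) * timingProcess X t ω

/-- The first time at which the process `W` takes the value `α`. -/
noncomputable def firstHitting {Ω : Type*} (W : ℝ≥0 → Ω → ℝ) (α : ℝ) (ω : Ω) : ℝ≥0 :=
  sInf {t : ℝ≥0 | W t ω = α}

/-- The process `W` started at `α`: its evolution from the first time it hits `α` on. -/
noncomputable def startedAt {Ω : Type*} (W : ℝ≥0 → Ω → ℝ) (α : ℝ) (t : ℝ≥0) (ω : Ω) : ℝ :=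
  W (firstHitting W α ω + t) ω

/-- The haircut with cutoff length `c.1` and haircut time `c.2`, acting on the process `K`,
with `W` supplying the growth after the haircut: `K` is kept before the haircut time, and
from then on `W` started at the level `min (K c.2) c.1` is followed. -/
noncomputable def haircut {Ω : Type*} (c : ℝ≥0 × ℝ≥0) (W K : ℝ≥0 → Ω → ℝ)
    (t : ℝ≥0) (ω : Ω) : ℝ :=
  if t < c.2 then K t ω else startedAt W (min (K c.2 ω) (c.1 : ℝ)) (t - c.2) ω

/-- The result of letting the first `n` of the haircuts `c 0, c 1, …` act successively
on `G`, where `W k` supplies the growth after the haircut `c k`. -/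
noncomputable def haircutStage {Ω : Type*} (c : ℕ → ℝ≥0 × ℝ≥0) (W : ℕ → ℝ≥0 → Ω → ℝ)
    (G : ℝ≥0 → Ω → ℝ) : ℕ → ℝ≥0 → Ω → ℝ
  | 0 => G
  | n + 1 => haircut (c n) (W n) (haircutStage c W G n)

/-- The result of letting all the haircuts `c 0, c 1, …` act on `G`. When the haircut times
tend to infinity, the sequence whose limit is taken is eventually constant, since a haircut
does not change the process before its time. -/
noncomputable def haircutAll {Ω : Type*} (c : ℕ → ℝ≥0 × ℝ≥0) (W : ℕ → ℝ≥0 → Ω → ℝ)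
    (G : ℝ≥0 → Ω → ℝ) (t : ℝ≥0) (ω : Ω) : ℝ :=
  limUnder atTop (fun n => haircutStage c W G n t ω)

/-- `H` is a haircut process induced by the haircuts `c` from `G`, for growth rate `r` and
renewal rate `lam`. The growth after the haircut `c n` is supplied by a growing process `W n`
whose inter-renewal times `X n` are independent of the path, up to the time of that haircut,
of the process that has received the haircuts before it. -/
structure IsHaircutProcess {Ω : Type*} [MeasurableSpace Ω] (r : ℝ≥0) (lam : ℝ)
    (c : ℕ → ℝ≥0 × ℝ≥0) (G H : ℝ≥0 → Ω → ℝ) (P : Measure Ω) : Prop where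
  exists_growth : ∃ (X : ℕ → ℕ → Ω → ℝ) (W : ℕ → ℝ≥0 → Ω → ℝ),
    (∀ n, IsGrowingProcess r lam (X n) (W n) P) ∧
    (∀ n, IndepFun (fun ω (j : ℕ) => X n j ω)
      (fun ω (t : Set.Iic (c n).2) => haircutStage c W G n t ω) P) ∧
    ∀ t ω, H t ω = haircutAll c W G t ω

/-!
The state of a growing process after a time `a` consists of its age `A` at that time and of the
sequence `D` formed by the residual time to the next renewal and the inter-renewal times after it.
Since `A + D 0` is the length of the interval that contains the starting time, the path is a
function `growthPath r (A, D)` of this pair, and it is enough to compare laws of such pairs.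

For the growing process `G` at the time `l / r`, and likewise for a growing process started at an
independent level `r * A`, the sequence `D` is independent of `A` and has the law of the original
inter-renewal times. Both facts are instances of `IsMemoryless.map_prodMk_dropSeq`: the starting
interval is the `n`-th one exactly if an event determined by the preceding inter-renewal times
occurs and the `n`-th one exceeds the age, which is also determined by the preceding ones; so the
memorylessness of the exponential law applies. In the first case the interval is the one that
contains the time `l / r`, in the second case it is the first one whose length exceeds `A`
(`startedAt_eq_age_dropSeq`).

It remains to compare the laws of `A`. The age at time `b` is at least `z ≤ b` if and only if the
residual time at `b - z` exceeds `z` (`IsRegularSeq.le_age_iff`), and the residual time has the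
inter-renewal law. So the age at time `b` is distributed as an inter-renewal time capped at `b`, and
the minimum of `l / r` and the age at a time `b ≥ l / r` is distributed as the age at `l / r`
(`IsMemoryless.map_min_age`). Before the first haircut this applies with `b = s`; before each later
one, the previous haircut leaves a process distributed as `G` from `l / r` on, and it applies with
`b = l / r + i`.
-/

/-! ### The age process of a deterministic sequence of inter-renewal times -/

/-- The time elapsed at time `t` since the last renewal, when the inter-renewal times are the
terms of the sequence `x`. It is meaningful for `t ≥ 0`, where the renewal at time `0` makes the set
nonempty. -/
noncomputable def age (x : ℕ → ℝ) (t : ℝ) : ℝ :=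
  sInf {z : ℝ | ∃ n : ℕ, z = t - ∑ j ∈ Finset.range n, x j ∧ 0 ≤ z}

/-- A sequence of inter-renewal times that is positive and unbounded. Positivity orders the renewal
times, and unboundedness makes them tend to infinity and makes the age process reach every level. -/
def IsRegularSeq (x : ℕ → ℝ) : Prop :=
  (∀ j, 0 < x j) ∧ ∀ c : ℝ, ∃ j, c < x j

/-- The sequence `x` without its first `n` terms. -/
def dropSeq (n : ℕ) (x : ℕ → ℝ) (j : ℕ) : ℝ := x (n + j)

/-- The sequence `x` with its first term increased by `a`. -/
def addHead (a : ℝ) (x : ℕ → ℝ) (j : ℕ) : ℝ := x j + if j = 0 then a else 0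

/-- The index of the inter-renewal interval that contains the time `t`, the intervals being closed
on the left and open on the right, and `0` if there is none. -/
noncomputable def intervalIndex (t : ℝ) (x : ℕ → ℝ) : ℕ :=
  sInf {n | t < ∑ j ∈ Finset.range (n + 1), x j}

/-- The index of the first inter-renewal time that exceeds `a`, and `0` if there is none. -/
noncomputable def exceedIndex (a : ℝ) (x : ℕ → ℝ) : ℕ := sInf {n | a < x n}

theorem timingProcess_eq_age {Ω : Type*} (X : ℕ → Ω → ℝ) (t : ℝ≥0) (ω : Ω) :
    timingProcess X t ω = age (fun j => X j ω) t := rfl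

theorem sum_range_strictMono {x : ℕ → ℝ} (hx : ∀ j, 0 < x j) :
    StrictMono fun n => ∑ j ∈ Finset.range n, x j :=
  strictMono_nat_of_lt_succ fun n => by
    rw [Finset.sum_range_succ]; linarith [hx n]

theorem age_eq_sub {x : ℕ → ℝ} (hx : ∀ j, 0 < x j) {t : ℝ} {n : ℕ}
    (h₁ : ∑ j ∈ Finset.range n, x j ≤ t) (h₂ : t < ∑ j ∈ Finset.range (n + 1), x j) :
    age x t = t - ∑ j ∈ Finset.range n, x j := by
  refine IsLeast.csInf_eq ⟨⟨n, rfl, by linarith⟩, ?_⟩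
  rintro _ ⟨m, rfl, hm⟩
  have hmn : m < n + 1 :=
    (sum_range_strictMono hx).lt_iff_lt.1 (lt_of_le_of_lt (sub_nonneg.1 hm) h₂)
  have := (sum_range_strictMono hx).monotone (Nat.lt_succ_iff.1 hmn)
  linarith

namespace IsRegularSeq

variable {x : ℕ → ℝ}

theorem exists_lt_sum (hx : IsRegularSeq x) (t : ℝ) :
    ∃ n, t < ∑ j ∈ Finset.range (n + 1), x j := by
  obtain ⟨n, hn⟩ := hx.2 t
  refine ⟨n, hn.trans_le ?_⟩
  rw [Finset.sum_range_succ]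
  linarith [Finset.sum_nonneg fun j (_ : j ∈ Finset.range n) => (hx.1 j).le]

theorem dropSeq (hx : IsRegularSeq x) (n : ℕ) : IsRegularSeq (dropSeq n x) := by
  refine ⟨fun j => hx.1 _, fun c => ?_⟩
  obtain ⟨m, hm⟩ := hx.2 (max c (∑ j ∈ Finset.range n, x j))
  have hnm : n ≤ m := by
    by_contra! hlt
    have := Finset.single_le_sum (fun j _ => (hx.1 j).le) (Finset.mem_range.2 hlt)
    linarith [le_max_right c (∑ j ∈ Finset.range n, x j)]
  refine ⟨m - n, ?_⟩
  simpa [_root_.dropSeq, Nat.add_sub_cancel' hnm] using (le_max_left _ _).trans_lt hm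

theorem intervalIndex_eq_iff (hx : IsRegularSeq x) {t : ℝ} (ht : 0 ≤ t) {n : ℕ} :
    intervalIndex t x = n ↔
      ∑ j ∈ Finset.range n, x j ≤ t ∧ t < ∑ j ∈ Finset.range (n + 1), x j := by
  have hlt : t < ∑ j ∈ Finset.range (intervalIndex t x + 1), x j :=
    Nat.sInf_mem (s := {n | t < ∑ j ∈ Finset.range (n + 1), x j}) (hx.exists_lt_sum t)
  have hle : ∑ j ∈ Finset.range (intervalIndex t x), x j ≤ t := by
    rcases h : intervalIndex t x with _ | k
    · simpa using ht
    · by_contra! hk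
      have : intervalIndex t x ≤ k := Nat.sInf_le hk
      omega
  constructor
  · rintro rfl; exact ⟨hle, hlt⟩
  · rintro ⟨h₁, h₂⟩
    have i₁ := (sum_range_strictMono hx.1).lt_iff_lt.1 (h₁.trans_lt hlt)
    have i₂ := (sum_range_strictMono hx.1).lt_iff_lt.1 (hle.trans_lt h₂)
    omega

theorem age_eq (hx : IsRegularSeq x) {t : ℝ} (ht : 0 ≤ t) :
    age x t = t - ∑ j ∈ Finset.range (intervalIndex t x), x j :=
  have h := (hx.intervalIndex_eq_iff ht).1 rfl
  age_eq_sub hx.1 h.1 h.2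

theorem age_nonneg (hx : IsRegularSeq x) {t : ℝ} (ht : 0 ≤ t) : 0 ≤ age x t := by
  rw [hx.age_eq ht]
  linarith [((hx.intervalIndex_eq_iff ht).1 rfl).1]

theorem age_le (hx : IsRegularSeq x) {t : ℝ} (ht : 0 ≤ t) : age x t ≤ t := by
  rw [hx.age_eq ht]
  linarith [Finset.sum_nonneg fun j (_ : j ∈ Finset.range (intervalIndex t x)) => (hx.1 j).le]

/-- The age process regenerates at the renewal times. -/
theorem age_sum_add (hx : IsRegularSeq x) (n : ℕ) {v : ℝ} (hv : 0 ≤ v) :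
    age x (∑ j ∈ Finset.range n, x j + v) = age (_root_.dropSeq n x) v := by
  have h := ((hx.dropSeq n).intervalIndex_eq_iff hv).1 rfl
  set m := intervalIndex v (_root_.dropSeq n x)
  have hs : ∀ k, ∑ j ∈ Finset.range k, _root_.dropSeq n x j =
      ∑ j ∈ Finset.range (n + k), x j - ∑ j ∈ Finset.range n, x j := fun k => by
    rw [Finset.sum_range_add]; simp [_root_.dropSeq]
  rw [age_eq_sub (hx.dropSeq n).1 h.1 h.2, age_eq_sub (n := n + m) hx.1, hs]
  · ring
  · linarith [hs m]
  · have := hs (m + 1)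
    rw [← add_assoc] at this
    linarith

theorem age_add (hx : IsRegularSeq x) {a u : ℝ} (ha : 0 ≤ a) (hu : 0 ≤ u) :
    age x (a + u) = age (_root_.dropSeq (intervalIndex a x) x) (age x a + u) := by
  rw [← hx.age_sum_add _ (add_nonneg (hx.age_nonneg ha) hu), hx.age_eq ha]
  congr 1
  ring

theorem exceedIndex_eq_iff (hx : IsRegularSeq x) {a : ℝ} {n : ℕ} :
    exceedIndex a x = n ↔ (∀ j < n, x j ≤ a) ∧ a < x n := by
  have hlt : a < x (exceedIndex a x) := Nat.sInf_mem (s := {n | a < x n}) (hx.2 a)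
  constructor
  · rintro rfl
    exact ⟨fun j hj => not_lt.1 fun h => Nat.notMem_of_lt_sInf hj h, hlt⟩
  · rintro ⟨h₁, h₂⟩
    refine le_antisymm (Nat.sInf_le h₂) (not_lt.1 fun h => ?_)
    exact absurd hlt (not_lt.2 (h₁ _ h))

/-- The age is at least `z` at time `b` exactly if the inter-renewal interval that contains the time
`b - z` lasts beyond `b`. -/
theorem le_age_iff (hx : IsRegularSeq x) {z b : ℝ} (hz : 0 ≤ z) (hzb : z ≤ b) :
    z ≤ age x b ↔
      z < x (intervalIndex (b - z) x) - age x (b - z) := by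
  have h := (hx.intervalIndex_eq_iff (sub_nonneg.2 hzb)).1 rfl
  have hb := (hx.intervalIndex_eq_iff (hz.trans hzb)).1 rfl
  rw [hx.age_eq (sub_nonneg.2 hzb), hx.age_eq (hz.trans hzb)]
  set m := intervalIndex (b - z) x
  set k := intervalIndex b x
  rw [Finset.sum_range_succ _ m] at h
  constructor
  · intro hle
    have hkm : k < m + 1 := by
      refine (sum_range_strictMono hx.1).lt_iff_lt.1 ?_
      simp only [Finset.sum_range_succ _ m]
      linarith
    have : ∑ j ∈ Finset.range (k + 1), x j ≤ ∑ j ∈ Finset.range (m + 1), x j :=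
      (sum_range_strictMono hx.1).monotone hkm
    rw [Finset.sum_range_succ _ m] at this
    linarith
  · intro hlt
    have : k = m := (hx.intervalIndex_eq_iff (hz.trans hzb)).2
      ⟨by linarith, by rw [Finset.sum_range_succ]; linarith⟩
    rw [this]
    linarith

end IsRegularSeq

/-- The path of the process started at level `α` is read off, with the age `α / r` at its start,
from the inter-renewal times beginning with the first one that exceeds `α / r`. -/
theorem startedAt_eq_age_dropSeq {Ω : Type*} {r : ℝ≥0} (hr : 0 < r) {X : ℕ → Ω → ℝ}
    {W : ℝ≥0 → Ω → ℝ} (hW : ∀ t ω, W t ω = r * timingProcess X t ω) {ω : Ω}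
    (hx : IsRegularSeq fun j => X j ω) {a : ℝ} (ha : 0 ≤ a) (u : ℝ≥0) :
    startedAt W (r * a) u ω =
      r * age (dropSeq (exceedIndex a fun j => X j ω) fun j => X j ω) (a + u) := by
  set x : ℕ → ℝ := fun j => X j ω with hxdef
  have hN := hx.exceedIndex_eq_iff.1 (rfl : exceedIndex a x = _)
  set N := exceedIndex a x
  have hY : 0 ≤ ∑ j ∈ Finset.range N, x j := Finset.sum_nonneg fun j _ => (hx.1 j).le
  have hr' : (r : ℝ) ≠ 0 := by exact_mod_cast hr.ne'
  have hset : ∀ t : ℝ≥0, W t ω = r * a ↔ age x t = a := fun t => by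
    rw [hW, timingProcess_eq_age, mul_right_inj' hr']
  obtain ⟨T, hT⟩ : ∃ T : ℝ≥0, (T : ℝ) = ∑ j ∈ Finset.range N, x j + a :=
    ⟨Real.toNNReal _, Real.coe_toNNReal _ (add_nonneg hY ha)⟩
  have hfirst : firstHitting W (r * a) ω = T := by
    refine IsLeast.csInf_eq ⟨?_, fun t ht => ?_⟩
    · refine (hset T).2 ?_
      rw [hT, age_eq_sub (n := N) hx.1]
      · simp
      · simpa using ha
      · simpa [Finset.sum_range_succ] using hN.2
    -- An interval in which the age `a` is reached is longer than `a`, so not before the `N`-th.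
    · have hta := (hset t).1 ht
      rw [hx.age_eq t.coe_nonneg] at hta
      have hi := (hx.intervalIndex_eq_iff t.coe_nonneg).1 rfl
      set m := intervalIndex (t : ℝ) x
      rw [Finset.sum_range_succ] at hi
      have hNm : N ≤ m := not_lt.1 fun h => absurd (hN.1 m h) (by linarith)
      have : ∑ j ∈ Finset.range N, x j ≤ ∑ j ∈ Finset.range m, x j :=
        (sum_range_strictMono hx.1).monotone hNm
      rw [← NNReal.coe_le_coe, hT]
      linarith
  rw [startedAt, hfirst, hW, timingProcess_eq_age, ← hx.age_sum_add N (add_nonneg ha u.coe_nonneg),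
    NNReal.coe_add, hT, add_assoc]

/-! ### Memoryless laws -/

/-- A law on the line without memory: given that it exceeds a level `a ≥ 0`, a variable with this
law exceeds `a` by an amount with the same law. -/
def IsMemoryless (μ : Measure ℝ) : Prop :=
  ∀ a, 0 ≤ a → ∀ C, MeasurableSet C → μ {y | a < y ∧ y - a ∈ C} = μ (Set.Ioi a) * μ C

theorem expMeasure_Ioi {lam : ℝ} (hlam : 0 < lam) {a : ℝ} (ha : 0 ≤ a) :
    expMeasure lam (Set.Ioi a) = ENNReal.ofReal (Real.exp (-(lam * a))) := by
  have := isProbabilityMeasure_expMeasure hlam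
  rw [← measure_cdf (expMeasure lam), StieltjesFunction.measure_Ioi _ (tendsto_cdf_atTop _),
    cdf_expMeasure_eq hlam, if_pos ha]
  congr 1
  ring

theorem isMemoryless_expMeasure {lam : ℝ} (hlam : 0 < lam) : IsMemoryless (expMeasure lam) := by
  intro a ha C hC
  have := isProbabilityMeasure_expMeasure hlam
  have hmeas : Measurable fun y : ℝ => y - a := by fun_prop
  have key : ((expMeasure lam).restrict (Set.Ioi a)).map (fun y => y - a) =
      expMeasure lam (Set.Ioi a) • expMeasure lam := by
    refine Measure.ext_of_Iic _ _ fun z => ?_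
    rw [Measure.map_apply hmeas measurableSet_Iic,
      Measure.restrict_apply (hmeas measurableSet_Iic), Measure.smul_apply, smul_eq_mul,
      ← ofReal_cdf _ z, expMeasure_Ioi hlam ha]
    have : (fun y : ℝ => y - a) ⁻¹' Set.Iic z ∩ Set.Ioi a = Set.Ioc a (a + z) := by
      ext y
      simp only [Set.mem_inter_iff, Set.mem_preimage, Set.mem_Iic, Set.mem_Ioi, Set.mem_Ioc,
        sub_le_iff_le_add']
      tauto
    rw [this, ← ENNReal.ofReal_mul (Real.exp_nonneg _), ← measure_cdf (expMeasure lam),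
      StieltjesFunction.measure_Ioc, measure_cdf, cdf_expMeasure_eq hlam, cdf_expMeasure_eq hlam,
      cdf_expMeasure_eq hlam, if_pos ha]
    rcases lt_or_ge z 0 with hz | hz
    -- For `z < 0` both sides vanish.
    · rw [if_neg (not_le.2 hz), mul_zero, ENNReal.ofReal_zero, ENNReal.ofReal_eq_zero]
      split_ifs
      · have : lam * (a + z) ≤ lam * a := by nlinarith
        have := Real.exp_le_exp.2 (neg_le_neg this)
        linarith
      · have : Real.exp (-(lam * a)) ≤ 1 := Real.exp_le_one_iff.2 (by nlinarith)
        linarith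
    · rw [if_pos hz, if_pos (add_nonneg ha hz), mul_sub, ← Real.exp_add]
      congr 1
      ring_nf
  have h := congrArg (fun ν : Measure ℝ => ν C) key
  simp only [Measure.map_apply hmeas hC, Measure.restrict_apply (hmeas hC), Measure.smul_apply,
    smul_eq_mul] at h
  rw [← h]
  congr 1
  ext y
  simp [and_comm]

/-! ### Measurability of the age and of the selected indices -/

/-- The law of a sequence of independent variables with common law `μ`. -/
noncomputable abbrev iidSeq (μ : Measure ℝ) : Measure (ℕ → ℝ) := Measure.infinitePi fun _ => μ

@[fun_prop]
theorem measurable_dropSeq (n : ℕ) : Measurable (dropSeq n) :=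
  measurable_pi_lambda _ fun j => measurable_pi_apply (n + j)

@[fun_prop]
theorem Measurable.addHead {Ω : Type*} [MeasurableSpace Ω] {a : Ω → ℝ} {x : Ω → ℕ → ℝ}
    (ha : Measurable a) (hx : Measurable x) : Measurable fun ω => addHead (a ω) (x ω) := by
  refine measurable_pi_lambda _ fun j => ?_
  unfold _root_.addHead
  split_ifs <;> fun_prop

theorem addHead_addHead_neg (a : ℝ) (x : ℕ → ℝ) : addHead a (addHead (-a) x) = x := by
  ext j
  unfold addHead
  split_ifs <;> simp

theorem Measurable.dropSeq {Ω : Type*} [MeasurableSpace Ω] {N : Ω → ℕ} {x : Ω → ℕ → ℝ}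
    (hN : Measurable N) (hx : Measurable x) : Measurable fun ω => dropSeq (N ω) (x ω) := by
  have : Measurable fun q : ℕ × (ℕ → ℝ) => _root_.dropSeq q.1 q.2 :=
    measurable_from_prod_countable_right measurable_dropSeq
  exact this.comp (hN.prodMk hx)

theorem measurable_nat_sInf {Ω : Type*} [MeasurableSpace Ω] {p : ℕ → Ω → Prop}
    (hp : ∀ n, MeasurableSet {ω | p n ω}) : Measurable fun ω => sInf {n | p n ω} := by
  refine measurable_to_countable' fun n => ?_
  have : (fun ω => sInf {n | p n ω}) ⁻¹' {n} =
      ({ω | p n ω} ∩ ⋂ m, ⋂ (_ : m < n), {ω | p m ω}ᶜ) ∪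
        ({_ω | n = 0} ∩ ⋂ m, {ω | p m ω}ᶜ) := by
    ext ω
    simp only [Set.mem_preimage, Set.mem_singleton_iff, Set.mem_union, Set.mem_inter_iff,
      Set.mem_iInter, Set.mem_compl_iff]
    constructor
    · rintro rfl
      rcases Set.eq_empty_or_nonempty {n | p n ω} with h | h
      · exact .inr ⟨by change sInf _ = 0; rw [h, Nat.sInf_empty],
          fun m (hm : m ∈ {n | p n ω}) => by simp [h] at hm⟩
      · exact .inl ⟨Nat.sInf_mem h, fun m hm => Nat.notMem_of_lt_sInf hm⟩
    · rintro (⟨h₁, h₂⟩ | ⟨h₁, h₂⟩)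
      · refine le_antisymm (Nat.sInf_le h₁) (not_lt.1 fun h => h₂ _ h ?_)
        exact Nat.sInf_mem (s := {n | p n ω}) ⟨n, h₁⟩
      · have : {n | p n ω} = ∅ := Set.eq_empty_of_forall_notMem h₂
        rw [this, Nat.sInf_empty]
        exact Eq.symm h₁
  rw [this]
  refine ((hp n).inter (.iInter fun m => .iInter fun _ => (hp m).compl)).union
    ((MeasurableSet.const _).inter (.iInter fun m => (hp m).compl))

theorem measurable_intervalIndex (t : ℝ) : Measurable (intervalIndex t) :=
  measurable_nat_sInf fun n => measurableSet_lt (by fun_prop) (by fun_prop)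

theorem Measurable.exceedIndex {Ω : Type*} [MeasurableSpace Ω] {a : Ω → ℝ} {x : Ω → ℕ → ℝ}
    (ha : Measurable a) (hx : Measurable x) : Measurable fun ω => exceedIndex (a ω) (x ω) :=
  measurable_nat_sInf fun n => measurableSet_lt ha (by fun_prop)

@[fun_prop]
theorem Measurable.age {Ω : Type*} [MeasurableSpace Ω] {x : Ω → ℕ → ℝ} {t : Ω → ℝ≥0}
    (hx : Measurable x) (ht : Measurable t) : Measurable fun ω => age (x ω) (t ω) := by
  -- Renewals after `t` are replaced by the one at time `0`, so that the infimum runs over `ℕ`.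
  have : ∀ ω, _root_.age (x ω) (t ω) = ⨅ n : ℕ,
      if 0 ≤ (t ω : ℝ) - ∑ j ∈ Finset.range n, x ω j then
        (t ω : ℝ) - ∑ j ∈ Finset.range n, x ω j else t ω := by
    intro ω
    rw [_root_.age, iInf]
    congr 1
    ext z
    constructor
    · rintro ⟨n, rfl, hn⟩
      exact ⟨n, if_pos hn⟩
    · rintro ⟨n, rfl⟩
      dsimp only
      split_ifs with h
      · exact ⟨n, rfl, h⟩
      · exact ⟨0, by simp, by simp⟩
  simp_rw [this]
  refine Measurable.iInf fun n => Measurable.ite (measurableSet_le ?_ ?_) ?_ ?_ <;> fun_prop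

/-! ### Memorylessness for independent sequences -/

section

variable {μ : Measure ℝ} [IsProbabilityMeasure μ]

theorem map_dropSeq_iidSeq (n : ℕ) : (iidSeq μ).map (dropSeq n) = iidSeq μ :=
  Measure.map_infinitePi_infinitePi_of_inj (P := fun _ : ℕ => μ) (add_right_injective n)

theorem ae_isRegularSeq (hpos : μ (Set.Iic 0) = 0) (hlt : ∀ c, μ (Set.Iic c) < 1) :
    ∀ᵐ x ∂iidSeq μ, IsRegularSeq x := by
  have h₁ : ∀ᵐ x ∂iidSeq μ, ∀ j, 0 < x j := by
    refine ae_all_iff.2 fun j => ?_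
    have := (measurePreserving_eval_infinitePi (fun _ : ℕ => μ) j).measure_preimage
      (measurableSet_Iic (a := (0 : ℝ))).nullMeasurableSet
    rw [hpos] at this
    rw [ae_iff]
    convert this using 2
    ext x
    simp
  -- The first `n` terms are all at most `k` with probability `μ (Iic k) ^ n`.
  have h₂ : ∀ᵐ x ∂iidSeq μ, ∀ k : ℕ, ∃ j, (k : ℝ) < x j := by
    refine ae_all_iff.2 fun k => ?_
    rw [ae_iff]
    refine le_antisymm (ge_of_tendsto' (ENNReal.tendsto_pow_atTop_nhds_zero_of_lt_one (hlt k))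
      fun n => ?_) zero_le
    have := Measure.infinitePi_pi (fun _ : ℕ => μ) (s := Finset.range n)
      (t := fun _ => Set.Iic (k : ℝ)) fun _ _ => measurableSet_Iic
    rw [Finset.prod_const, Finset.card_range] at this
    rw [← this]
    refine measure_mono fun x hx j _ => ?_
    simp only [Set.mem_ofPred_eq, not_exists, not_lt] at hx
    exact hx j
  filter_upwards [h₁, h₂] with x hx₁ hx₂
  refine ⟨hx₁, fun c => ?_⟩
  obtain ⟨k, hk⟩ := exists_nat_ge c
  obtain ⟨j, hj⟩ := hx₂ k
  exact ⟨j, hk.trans_lt hj⟩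

/-- Given that the first term of an independent sequence with memoryless law exceeds `a`,
subtracting `a` from it does not change the law of the sequence. -/
theorem IsMemoryless.measure_addHead (hμ : IsMemoryless μ) {a : ℝ} (ha : 0 ≤ a) {C : Set (ℕ → ℝ)}
    (hC : MeasurableSet C) :
    iidSeq μ {x | a < x 0 ∧ addHead (-a) x ∈ C} = μ (Set.Ioi a) * iidSeq μ C := by
  have hE : MeasurableSet {x : ℕ → ℝ | a < x 0} := measurableSet_lt (by fun_prop) (by fun_prop)
  have hm : Measurable (addHead (-a)) := Measurable.addHead measurable_const measurable_id
  -- The event turns a box into a box with a modified side at the index `0`, which is inserted into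
  -- the index set where it is missing.
  have hbox : ∀ (s : Finset ℕ) (t : ℕ → Set ℝ), (∀ j, MeasurableSet (t j)) →
      iidSeq μ {x | a < x 0 ∧ addHead (-a) x ∈ (s : Set ℕ).pi t} =
        μ (Set.Ioi a) * ∏ j ∈ s, μ (t j) := by
    intro s t ht
    let t₀ : Set ℝ := if 0 ∈ s then t 0 else Set.univ
    have ht₀ : MeasurableSet t₀ := by
      unfold t₀; split_ifs; exacts [ht 0, .univ]
    have hset : {x : ℕ → ℝ | a < x 0 ∧ addHead (-a) x ∈ (s : Set ℕ).pi t} =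
        (↑(insert 0 (s.erase 0)) : Set ℕ).pi
          fun j => if j = 0 then {y | a < y ∧ y - a ∈ t₀} else t j := by
      ext x
      simp only [Set.mem_ofPred_eq, Set.mem_pi, Finset.coe_insert, Finset.coe_erase,
        Set.mem_insert_iff, Set.mem_sdiff, Finset.mem_coe, Set.mem_singleton_iff, addHead, t₀]
      constructor
      · rintro ⟨h₁, h₂⟩ j hj
        by_cases hj0 : j = 0
        · subst hj0
          refine ⟨h₁, ?_⟩
          split_ifs with hs
          · simpa [sub_eq_add_neg] using h₂ 0 hs
          · trivial
        · simpa [hj0] using h₂ j (by tauto)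
      · intro h
        have h0 := h 0 (Or.inl rfl)
        rw [if_pos rfl] at h0
        refine ⟨h0.1, fun j hj => ?_⟩
        by_cases hj0 : j = 0
        · subst hj0
          simpa [hj, sub_eq_add_neg] using h0.2
        · simpa [hj0] using h j (Or.inr ⟨hj, hj0⟩)
    rw [hset, Measure.infinitePi_pi, Finset.prod_insert (Finset.notMem_erase 0 s), if_pos rfl,
      hμ a ha _ ht₀, mul_assoc]
    · congr 1
      rw [Finset.prod_congr rfl fun j hj => by rw [if_neg (Finset.ne_of_mem_erase hj)]]
      by_cases hs : 0 ∈ s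
      · rw [← Finset.mul_prod_erase s _ hs]
        simp [t₀, hs]
      · simp [t₀, hs]
    · intro j _
      split_ifs
      · exact measurableSet_Ioi.inter (ht₀.preimage (by fun_prop))
      · exact ht j
  rcases eq_or_ne (μ (Set.Ioi a)) 0 with h0 | h0
  · have := hbox ∅ (fun _ => Set.univ) fun _ => .univ
    rw [h0, zero_mul] at this ⊢
    exact measure_mono_null
      (fun x (hx : a < x 0 ∧ addHead (-a) x ∈ C) => And.intro hx.1 (by simp)) this
  have hfin : μ (Set.Ioi a) ≠ ⊤ := measure_ne_top _ _
  -- The conditional law agrees with `iidSeq μ` on boxes.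
  have key : (μ (Set.Ioi a))⁻¹ •
      ((iidSeq μ).restrict {x | a < x 0}).map (addHead (-a)) = iidSeq μ := by
    refine Measure.eq_infinitePi _ fun s t ht => ?_
    have hst : MeasurableSet ((s : Set ℕ).pi t) := .pi s.countable_toSet fun j _ => ht j
    rw [Measure.smul_apply, Measure.map_apply hm hst, Measure.restrict_apply (hm hst),
      smul_eq_mul, Set.inter_comm]
    refine (congrArg _ (hbox s t ht)).trans ?_
    rw [← mul_assoc, ENNReal.inv_mul_cancel h0 hfin, one_mul]
  have := congrArg (fun ν : Measure (ℕ → ℝ) => ν C) key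
  simp only [Measure.smul_apply, Measure.map_apply hm hC, Measure.restrict_apply (hm hC),
    smul_eq_mul] at this
  rw [← this, ← mul_assoc, ENNReal.mul_inv_cancel h0 hfin, one_mul, Set.inter_comm]
  rfl

theorem indepFun_prefix_dropSeq (n : ℕ) :
    IndepFun (fun x (j : Fin n) => x j) (dropSeq n) (iidSeq μ) := by
  have hi : iIndepFun (fun (j : ℕ) (x : ℕ → ℝ) => x j) (iidSeq μ) :=
    iIndepFun_infinitePi (P := fun _ : ℕ => μ) (X := fun _ y => y) fun _ => measurable_id
  have := indep_iSup_of_disjoint (fun j => (measurable_pi_apply j).comap_le) hi.iIndep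
    (S := Set.Iio n) (T := Set.Ici n)
    (Set.disjoint_left.2 fun j h₁ h₂ => absurd (Set.mem_Iio.1 h₁) (not_lt.2 h₂))
  rw [IndepFun_iff_Indep]
  refine indep_of_indep_of_le_left (indep_of_indep_of_le_right this ?_) ?_
  · rw [MeasurableSpace.pi, MeasurableSpace.comap_iSup]
    refine iSup_le fun j => ?_
    rw [MeasurableSpace.comap_comp]
    exact le_iSup₂_of_le (n + j) (Nat.le_add_right n j) le_rfl
  · rw [MeasurableSpace.pi, MeasurableSpace.comap_iSup]
    refine iSup_le fun j => ?_
    rw [MeasurableSpace.comap_comp]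
    exact le_iSup₂_of_le (j : ℕ) j.2 le_rfl

/-- Memorylessness at a level `f` that is determined by the first `n` terms, on an event `F`
determined by them. -/
theorem IsMemoryless.measure_addHead_dropSeq (hμ : IsMemoryless μ) {n : ℕ} {f : (Fin n → ℝ) → ℝ}
    (hf : Measurable f) {F : Set (Fin n → ℝ)} (hF : MeasurableSet F) (hfF : ∀ p ∈ F, 0 ≤ f p)
    {C : Set (ℕ → ℝ)} (hC : MeasurableSet C) :
    iidSeq μ {x | ((fun j : Fin n => x j) ∈ F ∧ f (fun j => x j) < x n) ∧
        addHead (-f fun j => x j) (dropSeq n x) ∈ C} =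
      iidSeq μ {x | (fun j : Fin n => x j) ∈ F ∧ f (fun j => x j) < x n} *
        iidSeq μ C := by
  have hpre : Measurable fun (x : ℕ → ℝ) (j : Fin n) => x j := by fun_prop
  have hprod := (indepFun_prefix_dropSeq (μ := μ) n).map_prod_eq_prod_map_map
    hpre.aemeasurable (measurable_dropSeq n).aemeasurable
  rw [map_dropSeq_iidSeq] at hprod
  set ρ := (iidSeq μ).map fun x (j : Fin n) => x j
  have key : ∀ C : Set (ℕ → ℝ), MeasurableSet C →
      iidSeq μ {x | ((fun j : Fin n => x j) ∈ F ∧ f (fun j => x j) < x n) ∧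
        addHead (-f fun j => x j) (dropSeq n x) ∈ C} =
      (∫⁻ p, F.indicator (fun p => μ (Set.Ioi (f p))) p ∂ρ) * iidSeq μ C := by
    intro C hC
    let S : Set ((Fin n → ℝ) × (ℕ → ℝ)) :=
      {q | (q.1 ∈ F ∧ f q.1 < q.2 0) ∧ addHead (-f q.1) q.2 ∈ C}
    have hS₂ : MeasurableSet {q : (Fin n → ℝ) × (ℕ → ℝ) | f q.1 < q.2 0} :=
      measurableSet_lt (by fun_prop) (by fun_prop)
    have hS₃ : Measurable fun q : (Fin n → ℝ) × (ℕ → ℝ) => addHead (-f q.1) q.2 := by fun_prop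
    have hS : MeasurableSet S := ((hF.preimage measurable_fst).inter hS₂).inter (hC.preimage hS₃)
    calc _ = (iidSeq μ).map (fun x => (fun j : Fin n => x j, dropSeq n x)) S := by
          rw [Measure.map_apply (by fun_prop) hS]
          rfl
      _ = ∫⁻ p, F.indicator (fun p => μ (Set.Ioi (f p))) p * iidSeq μ C ∂ρ := by
          rw [hprod, Measure.prod_apply hS]
          refine lintegral_congr fun p => ?_
          by_cases hp : p ∈ F
          · rw [Set.indicator_of_mem hp, ← hμ.measure_addHead (hfF p hp) hC]
            congr 1
            ext y
            simp [S, hp]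
          · rw [Set.indicator_of_notMem hp, zero_mul]
            convert measure_empty (μ := iidSeq μ)
            ext y
            simp [S, hp]
      _ = _ := lintegral_mul_const' _ _ (measure_ne_top _ _)
  rw [key C hC]
  -- Taking `C = univ` identifies the integral.
  have := key Set.univ .univ
  rw [measure_univ, mul_one] at this
  rw [← this]
  simp

theorem measure_eq_tsum_inter_preimage {Ω : Type*} [MeasurableSpace Ω] {P : Measure Ω} {N : Ω → ℕ}
    (hN : Measurable N) {S : Set Ω} (hS : MeasurableSet S) :
    P S = ∑' n, P (S ∩ N ⁻¹' {n}) := by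
  rw [← measure_iUnion]
  · congr 1
    ext ω
    simp
  · exact fun m n hmn => Set.disjoint_left.2 fun ω h₁ h₂ => hmn (h₁.2.symm.trans h₂.2)
  · exact fun n => hS.inter (hN (measurableSet_singleton n))

/-- Memorylessness at a random index. Suppose that whether an index `n` is the selected one `N` is
decided by an event `F n` and a level `f n`, both determined by the terms before the `n`-th, the
other requirement being that the `n`-th term exceeds the level. Then the sequence from the selected
index on, with the level `A` subtracted from its first term, is independent of the level and has the
law of the whole sequence. -/
theorem IsMemoryless.map_prodMk_dropSeq (hμ : IsMemoryless μ) {N : (ℕ → ℝ) → ℕ}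
    {A : (ℕ → ℝ) → ℝ} (hN : Measurable N) (hA : Measurable A)
    (f : ∀ n, (Fin n → ℝ) → ℝ) (hf : ∀ n, Measurable (f n))
    (F : ∀ n, Set (Fin n → ℝ)) (hF : ∀ n, MeasurableSet (F n)) (hfF : ∀ n, ∀ p ∈ F n, 0 ≤ f n p)
    (hNF : ∀ᵐ x ∂iidSeq μ, ∀ n, N x = n ↔
      (fun j : Fin n => x j) ∈ F n ∧ f n (fun j => x j) < x n)
    (hAf : ∀ᵐ x ∂iidSeq μ, A x = f (N x) fun j => x j) :
    (iidSeq μ).map (fun x => (A x, addHead (-A x) (dropSeq (N x) x))) =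
      ((iidSeq μ).map A).prod (iidSeq μ) := by
  have hD : Measurable fun x => addHead (-A x) (dropSeq (N x) x) :=
    hA.neg.addHead (hN.dropSeq measurable_id)
  have := Measure.isProbabilityMeasure_map (μ := iidSeq μ) hA.aemeasurable
  refine (Measure.prod_eq fun B C hB hC => ?_).symm
  have hABC := (hA.prodMk hD) (hB.prod hC)
  rw [Measure.map_apply (hA.prodMk hD) (hB.prod hC), Measure.map_apply hA hB,
    measure_eq_tsum_inter_preimage hN hABC, measure_eq_tsum_inter_preimage hN (hA hB),
    ← ENNReal.tsum_mul_right]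
  refine tsum_congr fun n => ?_
  have hF' : MeasurableSet (F n ∩ f n ⁻¹' B) := (hF n).inter (hf n hB)
  refine (measure_congr (Filter.eventuallyEq_set.2 ?_)).trans
    ((hμ.measure_addHead_dropSeq (hf n) hF' (fun p hp => hfF n p hp.1) hC).trans
      (congrArg (· * _) (measure_congr (Filter.eventuallyEq_set.2 ?_))))
  all_goals
    filter_upwards [hNF, hAf] with x h₁ h₂
    have h₃ := h₁ n
    by_cases hn : N x = n
    · subst hn
      have := h₃.1 rfl
      simp [h₂, this.1, this.2]
    · have := mt h₃.2 hn
      simp only [Set.mem_inter_iff, Set.mem_preimage, Set.mem_singleton_iff, hn, and_false,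
        false_iff, iff_false]
      tauto

/-! ### Age and residual time -/

/-- At a fixed time `a`, the sequence of the residual time and the later inter-renewal times is
independent of the age and has the law of the original sequence. -/
theorem IsMemoryless.map_age_prodMk (hμ : IsMemoryless μ)
    (hreg : ∀ᵐ x ∂iidSeq μ, IsRegularSeq x) (a : ℝ≥0) :
    (iidSeq μ).map
        (fun x => (age x a, addHead (-age x a) (dropSeq (intervalIndex a x) x))) =
      ((iidSeq μ).map fun x => age x a).prod (iidSeq μ) := by
  refine hμ.map_prodMk_dropSeq (measurable_intervalIndex a) (by fun_prop)
    (fun n p => a - ∑ j, p j) (fun n => by fun_prop) (fun n => {p | ∑ j, p j ≤ a})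
    (fun n => measurableSet_le (by fun_prop) measurable_const) (fun n p hp => sub_nonneg.2 hp) ?_ ?_
  · filter_upwards [hreg] with x hx n
    rw [hx.intervalIndex_eq_iff a.coe_nonneg, Finset.sum_range_succ, ← Fin.sum_univ_eq_sum_range x,
      ← sub_lt_iff_lt_add']
  · filter_upwards [hreg] with x hx
    rw [hx.age_eq a.coe_nonneg, Fin.sum_univ_eq_sum_range x]

theorem IsMemoryless.map_addHead_dropSeq_intervalIndex (hμ : IsMemoryless μ)
    (hreg : ∀ᵐ x ∂iidSeq μ, IsRegularSeq x) (a : ℝ≥0) :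
    (iidSeq μ).map (fun x => addHead (-age x a) (dropSeq (intervalIndex a x) x)) =
      iidSeq μ := by
  have h := congrArg Measure.snd (hμ.map_age_prodMk hreg a)
  have hA : Measurable fun x : ℕ → ℝ => age x a := by fun_prop
  have := Measure.isProbabilityMeasure_map (μ := iidSeq μ) hA.aemeasurable
  rwa [Measure.snd_map_prodMk hA, Measure.snd_prod] at h

theorem IsMemoryless.map_addHead_dropSeq_exceedIndex (hμ : IsMemoryless μ)
    (hreg : ∀ᵐ x ∂iidSeq μ, IsRegularSeq x) {a : ℝ} (ha : 0 ≤ a) :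
    (iidSeq μ).map (fun x => addHead (-a) (dropSeq (exceedIndex a x) x)) =
      iidSeq μ := by
  have hN : Measurable (exceedIndex a) := measurable_const.exceedIndex measurable_id
  have h := congrArg Measure.snd <| hμ.map_prodMk_dropSeq hN (measurable_const (a := a))
    (fun n _ => a) (fun n => measurable_const) (fun n => {p | ∀ j, p j ≤ a})
    (fun n => ?_) (fun _ _ _ => ha) ?_ (.of_forall fun _ => rfl)
  · have := Measure.isProbabilityMeasure_map (μ := iidSeq μ)
      (measurable_const (a := a)).aemeasurable
    rwa [Measure.snd_map_prodMk measurable_const, Measure.snd_prod] at h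
  · simp only [Set.ofPred_forall]
    exact .iInter fun j => measurableSet_le (measurable_pi_apply j) measurable_const
  · filter_upwards [hreg] with x hx n
    rw [hx.exceedIndex_eq_iff, ← Fin.forall_iff (p := fun j : Fin n => x j ≤ a)]

/-- If the level `A` is independent of the sequence `x`, then the sequence from the first term
exceeding `A` on, with `A` subtracted from this term, is independent of `A` and has the law
of `x`. -/
theorem IsMemoryless.map_prodMk_exceedIndex (hμ : IsMemoryless μ)
    (hreg : ∀ᵐ x ∂iidSeq μ, IsRegularSeq x) {Ω : Type*} [MeasurableSpace Ω] {P : Measure Ω}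
    [IsProbabilityMeasure P] {A : Ω → ℝ} {x : Ω → ℕ → ℝ} (hA : Measurable A) (hx : Measurable x)
    (hA₀ : ∀ᵐ ω ∂P, 0 ≤ A ω) (hlaw : P.map x = iidSeq μ) (hind : IndepFun A x P) :
    P.map (fun ω => (A ω, addHead (-A ω) (dropSeq (exceedIndex (A ω) (x ω)) (x ω)))) =
      (P.map A).prod (iidSeq μ) := by
  have := Measure.isProbabilityMeasure_map (μ := P) hA.aemeasurable
  have hg : Measurable fun q : ℝ × (ℕ → ℝ) =>
      (q.1, addHead (-q.1) (dropSeq (exceedIndex q.1 q.2) q.2)) :=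
    measurable_fst.prodMk (measurable_fst.neg.addHead
      ((measurable_fst.exceedIndex measurable_snd).dropSeq measurable_snd))
  -- By independence the level may be fixed, which reduces the claim to a constant level.
  have hjoint := hind.map_prod_eq_prod_map_map hA.aemeasurable hx.aemeasurable
  have hmap : P.map (fun ω => (A ω, addHead (-A ω) (dropSeq (exceedIndex (A ω) (x ω)) (x ω)))) =
      ((P.map A).prod (iidSeq μ)).map
        fun q => (q.1, addHead (-q.1) (dropSeq (exceedIndex q.1 q.2) q.2)) := by
    rw [← hlaw, ← hjoint, Measure.map_map hg (hA.prodMk hx)]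
    rfl
  rw [hmap]
  refine (Measure.prod_eq fun B C hB hC => ?_).symm
  rw [Measure.map_apply hg (hB.prod hC), Measure.prod_apply (hg (hB.prod hC)),
    ← lintegral_indicator_one hB, ← lintegral_mul_const' _ _ (measure_ne_top _ _)]
  refine lintegral_congr_ae ?_
  filter_upwards [(ae_map_iff hA.aemeasurable measurableSet_Ici).2 hA₀] with a ha
  by_cases haB : a ∈ B
  · have hm : Measurable fun y : ℕ → ℝ => addHead (-a) (dropSeq (exceedIndex a y) y) :=
      measurable_const.addHead ((measurable_const.exceedIndex measurable_id).dropSeq measurable_id)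
    have hres := congrArg (fun ν : Measure (ℕ → ℝ) => ν C)
      (hμ.map_addHead_dropSeq_exceedIndex hreg ha)
    simp only [Measure.map_apply hm hC] at hres
    rw [Set.indicator_of_mem haB, Pi.one_apply, one_mul, ← hres]
    congr 1
    ext y
    simp [haB]
  · rw [Set.indicator_of_notMem haB, zero_mul]
    convert measure_empty (μ := iidSeq μ)
    ext y
    simp [haB]

theorem IsMemoryless.measure_le_age (hμ : IsMemoryless μ)
    (hreg : ∀ᵐ x ∂iidSeq μ, IsRegularSeq x) {z b : ℝ≥0} (hzb : z ≤ b) :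
    iidSeq μ {x | (z : ℝ) ≤ age x b} = μ (Set.Ioi z) := by
  have hm : Measurable fun x =>
      addHead (-age x (b - z : ℝ≥0)) (dropSeq (intervalIndex (b - z : ℝ≥0) x) x) :=
    Measurable.addHead (Measurable.neg (by fun_prop))
      ((measurable_intervalIndex _).dropSeq measurable_id)
  have hset : MeasurableSet {y : ℕ → ℝ | (z : ℝ) < y 0} :=
    measurableSet_lt (by fun_prop) (by fun_prop)
  have h := congrArg (fun ν : Measure (ℕ → ℝ) => ν {y | (z : ℝ) < y 0})
    (hμ.map_addHead_dropSeq_intervalIndex hreg (b - z))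
  have h0 := (measurePreserving_eval_infinitePi (fun _ : ℕ => μ) 0).measure_preimage
    (measurableSet_Ioi (a := (z : ℝ))).nullMeasurableSet
  simp only [Measure.map_apply hm hset] at h
  -- `h` gives the law of the residual time at `b - z`.
  refine (measure_congr (Filter.eventuallyEq_set.2 ?_)).trans (h.trans h0)
  filter_upwards [hreg] with x hx
  simp only [Set.mem_preimage, Set.mem_ofPred_eq]
  rw [hx.le_age_iff z.coe_nonneg (NNReal.coe_le_coe.2 hzb), NNReal.coe_sub hzb]
  simp [addHead, dropSeq, sub_eq_add_neg]

/-- The age at time `a` has the law of an inter-renewal time capped at `a`, and the age at a later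
time `b` has the law of one capped at `b`, so that capping the latter at `a` gives the former. -/
theorem IsMemoryless.map_min_age (hμ : IsMemoryless μ)
    (hreg : ∀ᵐ x ∂iidSeq μ, IsRegularSeq x) {a b : ℝ≥0} (hab : a ≤ b) :
    (iidSeq μ).map (fun x => min (age x b) a) =
      (iidSeq μ).map (fun x => age x a) := by
  have hma : Measurable fun x : ℕ → ℝ => age x a := by fun_prop
  have hmb : Measurable fun x : ℕ → ℝ => min (age x b) a := by fun_prop
  have := Measure.isProbabilityMeasure_map (μ := iidSeq μ) hmb.aemeasurable
  refine Measure.ext_of_Ici _ _ fun z => ?_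
  rw [Measure.map_apply hma measurableSet_Ici, Measure.map_apply hmb measurableSet_Ici]
  rcases le_or_gt z 0 with hz | hz
  · refine measure_congr (Filter.eventuallyEq_set.2 ?_)
    filter_upwards [hreg] with x hx
    simp [hz.trans (hx.age_nonneg a.coe_nonneg), hz.trans (hx.age_nonneg b.coe_nonneg),
      hz.trans a.coe_nonneg]
  lift z to ℝ≥0 using hz.le
  rcases le_or_gt z a with hza | hza
  · refine Eq.trans ?_ ((hμ.measure_le_age hreg (hza.trans hab)).trans
      (hμ.measure_le_age hreg hza).symm)
    congr 1
    ext x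
    simp [hza]
  · refine measure_congr (Filter.eventuallyEq_set.2 ?_)
    filter_upwards [hreg] with x hx
    have := (hx.age_le a.coe_nonneg).trans_lt (NNReal.coe_lt_coe.2 hza)
    simp only [Set.mem_preimage, Set.mem_Ici, le_min_iff, NNReal.coe_le_coe, not_le.2 hza,
      not_le.2 this, and_false]

end

/-! ### Laws of the paths of growing processes -/

theorem ae_isRegularSeq_expMeasure {lam : ℝ} (hlam : 0 < lam) :
    ∀ᵐ x ∂iidSeq (expMeasure lam), IsRegularSeq x := by
  have := isProbabilityMeasure_expMeasure hlam
  have hcdf : ∀ c, 0 ≤ c →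
      expMeasure lam (Set.Iic c) = ENNReal.ofReal (1 - Real.exp (-(lam * c))) := fun c hc => by
    rw [← ofReal_cdf, cdf_expMeasure_eq hlam, if_pos hc]
  refine ae_isRegularSeq (by simp [hcdf 0 le_rfl]) fun c => ?_
  refine (measure_mono (Set.Iic_subset_Iic.2 (le_max_left c 0))).trans_lt ?_
  rw [hcdf _ (le_max_right c 0), ENNReal.ofReal_lt_one]
  linarith [Real.exp_pos (-(lam * max c 0))]

section

variable {Ω : Type*} [MeasurableSpace Ω] {P : Measure Ω}
  {X : ℕ → Ω → ℝ} {r : ℝ≥0} {lam : ℝ}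

theorem IsInterRenewal.measurable_seq {ν : Measure ℝ} (hX : IsInterRenewal X ν P) :
    Measurable fun ω j => X j ω :=
  measurable_pi_lambda _ hX.measurable

theorem IsInterRenewal.map_eq_iidSeq {ν : Measure ℝ} (hX : IsInterRenewal X ν P) :
    P.map (fun ω j => X j ω) = iidSeq ν := by
  rw [hX.indep.map_fun_eq_infinitePi_map hX.measurable]
  simp_rw [hX.law]

theorem IsInterRenewal.ae_isRegularSeq (hlam : 0 < lam)
    (hX : IsInterRenewal X (expMeasure lam) P) : ∀ᵐ ω ∂P, IsRegularSeq fun j => X j ω := by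
  have h := ae_isRegularSeq_expMeasure hlam
  rw [← hX.map_eq_iidSeq] at h
  exact ae_of_ae_map hX.measurable_seq.aemeasurable h

/-- The path of the growing process with rate `r` whose initial age is `q.1`, when `q.2` is the
sequence of the residual time until the first renewal and the later inter-renewal times. -/
noncomputable def growthPath (r : ℝ≥0) (q : ℝ × (ℕ → ℝ)) (u : ℝ≥0) : ℝ :=
  r * age (addHead q.1 q.2) (q.1.toNNReal + u : ℝ≥0)

theorem measurable_growthPath (r : ℝ≥0) : Measurable (growthPath r) :=
  measurable_pi_lambda _ fun u => by unfold growthPath; fun_prop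

theorem IsGrowingProcess.eq_growthPath {G : ℝ≥0 → Ω → ℝ} (hG : IsGrowingProcess r lam X G P)
    {ω : Ω} (hx : IsRegularSeq fun j => X j ω) (a : ℝ≥0) :
    (fun u => G (a + u) ω) =
      growthPath r (age (fun j => X j ω) a, addHead (-age (fun j => X j ω) a)
        (dropSeq (intervalIndex a fun j => X j ω) fun j => X j ω)) := by
  ext u
  rw [growthPath, addHead_addHead_neg, NNReal.coe_add,
    Real.coe_toNNReal _ (hx.age_nonneg a.coe_nonneg), ← hx.age_add a.coe_nonneg u.coe_nonneg,
    hG.eq_scaled, timingProcess_eq_age, NNReal.coe_add]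

theorem IsGrowingProcess.startedAt_eq_growthPath (hr : 0 < r) {W : ℝ≥0 → Ω → ℝ}
    (hW : IsGrowingProcess r lam X W P) {ω : Ω} (hx : IsRegularSeq fun j => X j ω) {a : ℝ}
    (ha : 0 ≤ a) :
    (fun u => startedAt W (r * a) u ω) =
      growthPath r (a, addHead (-a)
        (dropSeq (exceedIndex a fun j => X j ω) fun j => X j ω)) := by
  ext u
  rw [growthPath, addHead_addHead_neg, NNReal.coe_add, Real.coe_toNNReal _ ha,
    startedAt_eq_age_dropSeq hr hW.eq_scaled hx ha]

/-- The law of a growing process from time `a` on, in terms of its age at time `a`. -/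
theorem IsGrowingProcess.hasLaw_shift (hlam : 0 < lam) {G : ℝ≥0 → Ω → ℝ}
    (hG : IsGrowingProcess r lam X G P) (a : ℝ≥0) :
    HasLaw (fun ω u => G (a + u) ω)
      ((((iidSeq (expMeasure lam)).map fun x => age x a).prod (iidSeq (expMeasure lam))).map
        (growthPath r)) P := by
  have := isProbabilityMeasure_expMeasure hlam
  have hx := hG.interRenewal.measurable_seq
  let g : (ℕ → ℝ) → ℝ × (ℕ → ℝ) := fun x =>
    (age x a, addHead (-age x a) (dropSeq (intervalIndex a x) x))
  have hg : Measurable g := Measurable.prodMk (by fun_prop) (Measurable.addHead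
    (Measurable.neg (by fun_prop)) ((measurable_intervalIndex _).dropSeq measurable_id))
  have heq : (fun ω u => G (a + u) ω) =ᵐ[P] growthPath r ∘ g ∘ fun ω j => X j ω := by
    filter_upwards [hG.interRenewal.ae_isRegularSeq hlam] with ω hω
    exact hG.eq_growthPath hω a
  have hm := (measurable_growthPath r).comp (hg.comp hx)
  refine ⟨⟨_, hm, heq⟩, ?_⟩
  rw [Measure.map_congr heq, ← Measure.map_map (measurable_growthPath r) (hg.comp hx),
    ← Measure.map_map hg hx, hG.interRenewal.map_eq_iidSeq,
    (isMemoryless_expMeasure hlam).map_age_prodMk (ae_isRegularSeq_expMeasure hlam)]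

/-- A growing process that is started at a random level, independent of its inter-renewal times and
distributed as the level of a growing process at time `a`, evolves in law as the latter does from
time `a` on. -/
theorem IsGrowingProcess.hasLaw_startedAt [IsProbabilityMeasure P] (hr : 0 < r)
    (hlam : 0 < lam) {W : ℝ≥0 → Ω → ℝ}
    (hW : IsGrowingProcess r lam X W P) {A : Ω → ℝ} (hA : AEMeasurable A P)
    (hind : IndepFun A (fun ω j => X j ω) P) (a : ℝ≥0)
    (hlaw : P.map A = (iidSeq (expMeasure lam)).map fun x => age x a) :
    HasLaw (fun ω u => startedAt W (r * A ω) u ω)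
      ((((iidSeq (expMeasure lam)).map fun x => age x a).prod (iidSeq (expMeasure lam))).map
        (growthPath r)) P := by
  have := isProbabilityMeasure_expMeasure hlam
  have hx := hW.interRenewal.measurable_seq
  have hage : Measurable fun x : ℕ → ℝ => age x a := by fun_prop
  have hA₀ : ∀ᵐ ω ∂P, 0 ≤ A ω := by
    refine ae_of_ae_map hA ?_
    rw [hlaw, ae_map_iff hage.aemeasurable measurableSet_Ici]
    filter_upwards [ae_isRegularSeq_expMeasure hlam] with x hx using hx.age_nonneg a.coe_nonneg
  -- A measurable version of `A` makes the path almost surely equal to a measurable function.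
  let B := hA.mk A
  have hB : Measurable B := hA.measurable_mk
  have hAB : A =ᵐ[P] B := hA.ae_eq_mk
  have hB₀ : ∀ᵐ ω ∂P, 0 ≤ B ω := by
    filter_upwards [hA₀, hAB] with ω h₁ h₂ using h₂ ▸ h₁
  let g : Ω → ℝ × (ℕ → ℝ) := fun ω =>
    (B ω, addHead (-B ω) (dropSeq (exceedIndex (B ω) fun j => X j ω) fun j => X j ω))
  have hg : Measurable g := hB.prodMk (hB.neg.addHead ((hB.exceedIndex hx).dropSeq hx))
  have heq : (fun ω u => startedAt W (r * A ω) u ω) =ᵐ[P] growthPath r ∘ g := by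
    filter_upwards [hW.interRenewal.ae_isRegularSeq hlam, hAB, hB₀] with ω hω h₁ h₂
    rw [h₁]
    exact hW.startedAt_eq_growthPath hr hω h₂
  refine ⟨⟨_, (measurable_growthPath r).comp hg, heq⟩, ?_⟩
  rw [Measure.map_congr heq, ← Measure.map_map (measurable_growthPath r) hg,
    (isMemoryless_expMeasure hlam).map_prodMk_exceedIndex (ae_isRegularSeq_expMeasure hlam) hB hx
      hB₀ hW.interRenewal.map_eq_iidSeq (hind.congr hAB .rfl), ← Measure.map_congr hAB, hlaw]

theorem IsGrowingProcess.measurable {G : ℝ≥0 → Ω → ℝ} (hG : IsGrowingProcess r lam X G P)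
    (t : ℝ≥0) : Measurable (G t) := by
  have : G t = fun ω => r * age (fun j => X j ω) t := funext fun ω => hG.eq_scaled t ω
  rw [this]
  exact (hG.interRenewal.measurable_seq.age measurable_const).const_mul _

/-! ### Haircuts -/

/-- If a haircut with cutoff length `l` is applied at a time at which the process is distributed as
a growing process at some time `b ≥ l / r`, then afterwards it evolves in law as a growing process
does from time `l / r` on. -/
theorem IsGrowingProcess.identDistrib_startedAt_min [IsProbabilityMeasure P] (hr : 0 < r)
    (hlam : 0 < lam) {G : ℝ≥0 → Ω → ℝ} (hG : IsGrowingProcess r lam X G P)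
    {X' : ℕ → Ω → ℝ} {W : ℝ≥0 → Ω → ℝ}
    (hW : IsGrowingProcess r lam X' W P) {K : Ω → ℝ} (hind : IndepFun K (fun ω j => X' j ω) P)
    {l b : ℝ≥0} (hlb : l / r ≤ b) (hK : IdentDistrib K (G b) P P) :
    IdentDistrib (fun ω u => startedAt W (min (K ω) l) u ω) (fun ω u => G (l / r + u) ω) P P := by
  have := isProbabilityMeasure_expMeasure hlam
  have hr' : (0 : ℝ) < r := hr
  -- The level after the haircut, measured as an age.
  let φ : ℝ → ℝ := fun k => min (k / r) (l / r : ℝ≥0)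
  have hφ : Measurable φ := by fun_prop
  have hφK : ∀ ω, min (K ω) l = r * φ (K ω) := fun ω => by
    simp only [φ, NNReal.coe_div]
    rw [mul_min_of_nonneg _ _ hr'.le, mul_div_cancel₀ _ hr'.ne', mul_div_cancel₀ _ hr'.ne']
  have hlaw : P.map (φ ∘ K) = (iidSeq (expMeasure lam)).map fun x => age x (l / r : ℝ≥0) := by
    rw [(hK.comp hφ).map_eq, ← (isMemoryless_expMeasure hlam).map_min_age
      (ae_isRegularSeq_expMeasure hlam) hlb, ← hG.interRenewal.map_eq_iidSeq,
      Measure.map_map (by fun_prop) hG.interRenewal.measurable_seq]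
    congr 1
    ext ω
    simp only [φ, Function.comp_apply, hG.eq_scaled, timingProcess_eq_age,
      mul_div_cancel_left₀ _ hr'.ne']
  have h₁ := hW.hasLaw_startedAt hr hlam (hφ.comp_aemeasurable hK.aemeasurable_fst)
    (hind.comp hφ measurable_id) (l / r) hlaw
  have h₂ := hG.hasLaw_shift hlam (l / r)
  simp_rw [hφK]
  exact ⟨h₁.aemeasurable, h₂.aemeasurable, h₁.map_eq.trans h₂.map_eq.symm⟩

/-- From the time of the `n`-th haircut on, the process that has received the haircuts up to this
one evolves in law as a growing process does from time `l / r` on. -/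
theorem identDistrib_haircutStage_succ [IsProbabilityMeasure P] (hr : 0 < r) (hlam : 0 < lam)
    {G : ℝ≥0 → Ω → ℝ} (hG : IsGrowingProcess r lam X G P) {l s i : ℝ≥0} (hs : l ≤ r * s)
    {X' : ℕ → ℕ → Ω → ℝ} {W : ℕ → ℝ≥0 → Ω → ℝ}
    (hW : ∀ n, IsGrowingProcess r lam (X' n) (W n) P) {c : ℕ → ℝ≥0 × ℝ≥0}
    (hc : ∀ n, c n = (l, s + (n : ℝ≥0) * i))
    (hind : ∀ n, IndepFun (fun ω (j : ℕ) => X' n j ω)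
      (fun ω (t : Set.Iic (c n).2) => haircutStage c W G n t ω) P) (n : ℕ) :
    IdentDistrib (fun ω u => haircutStage c W G (n + 1) ((c n).2 + u) ω)
      (fun ω u => G (l / r + u) ω) P P := by
  have hstep : ∀ n (ω : Ω) (u : ℝ≥0), haircutStage c W G (n + 1) ((c n).2 + u) ω =
      startedAt (W n) (min (haircutStage c W G n (c n).2 ω) l) u ω := fun n ω u => by
    simp [haircutStage, haircut, hc]
  have hindep : ∀ n, IndepFun (haircutStage c W G n (c n).2) (fun ω j => X' n j ω) P := fun n =>
    ((hind n).comp measurable_id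
      (measurable_pi_apply (⟨(c n).2, Set.self_mem_Iic⟩ : Set.Iic (c n).2))).symm
  simp_rw [hstep]
  induction n with
  | zero =>
    refine hG.identDistrib_startedAt_min hr hlam (hW 0) (hindep 0) (b := s) ?_ ?_
    · rwa [div_le_iff₀' hr]
    · have : (c 0).2 = s := by simp [hc]
      rw [this]
      exact .refl (hG.measurable s).aemeasurable
  | succ n ih =>
    -- The previous haircut was `i` time units ago.
    refine hG.identDistrib_startedAt_min hr hlam (hW _) (hindep _) (b := l / r + i)
      le_self_add ?_
    have hn : (c (n + 1)).2 = (c n).2 + i := by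
      simp only [hc, Nat.cast_add, Nat.cast_one]; ring
    have hK : haircutStage c W G (n + 1) (c (n + 1)).2 =
        fun ω => startedAt (W n) (min (haircutStage c W G n (c n).2 ω) l) i ω :=
      funext fun ω => by rw [hn, hstep]
    rw [hK]
    exact ih.comp (measurable_pi_apply i)

end

/-- Before the times of the haircuts from the `n`-th one on, only the first `n` haircuts matter. -/
theorem haircutAll_eq_haircutStage {Ω : Type*} {c : ℕ → ℝ≥0 × ℝ≥0} {W : ℕ → ℝ≥0 → Ω → ℝ}
    {G : ℝ≥0 → Ω → ℝ} {t : ℝ≥0} {n : ℕ} (ht : ∀ m, n ≤ m → t < (c m).2) (ω : Ω) :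
    haircutAll c W G t ω = haircutStage c W G n t ω := by
  refine (tendsto_const_nhds.congr' ?_).limUnder_eq
  filter_upwards [eventually_ge_atTop n] with m hm
  induction m, hm using Nat.le_induction with
  | base => rfl
  | succ m hm ih => rw [ih, haircutStage, haircut, if_pos (ht m hm)]

theorem mainTheorem4 {Ω : Type*} [MeasurableSpace Ω] (P : Measure Ω) [IsProbabilityMeasure P]
    (r : ℝ≥0) (hr : 0 < r) (lam : ℝ) (hlam : 0 < lam)
    (X : ℕ → Ω → ℝ) (G : ℝ≥0 → Ω → ℝ) (hG : IsGrowingProcess r lam X G P)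
    (l s i : ℝ≥0) (hs : l ≤ r * s) (hi : 0 < i)
    (H : ℝ≥0 → Ω → ℝ)
    (hH : IsHaircutProcess r lam (fun n : ℕ => (l, s + (n : ℝ≥0) * i)) G H P)
    (n : ℕ) :
    IdentDistrib
      (fun ω (u : Set.Ico (0 : ℝ≥0) i) => H (s + (n : ℝ≥0) * i + u) ω)
      (fun ω (u : Set.Ico (0 : ℝ≥0) i) => G (l / r + u) ω) P P := by
  obtain ⟨X', W, hW, hind, hHall⟩ := hH.exists_growth
  have hstage := identDistrib_haircutStage_succ hr hlam hG hs hW (fun _ => rfl) hind n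
  have hres : Measurable fun (p : ℝ≥0 → ℝ) (u : Set.Ico (0 : ℝ≥0) i) => p u := by fun_prop
  suffices hHstage : (fun ω (u : Set.Ico (0 : ℝ≥0) i) => H (s + (n : ℝ≥0) * i + u) ω) =
      fun ω (u : Set.Ico (0 : ℝ≥0) i) => haircutStage (fun n : ℕ => (l, s + (n : ℝ≥0) * i)) W G
        (n + 1) (s + (n : ℝ≥0) * i + u) ω by
    rw [hHstage]
    exact hstage.comp hres
  ext ω u
  rw [hHall]
  refine haircutAll_eq_haircutStage (fun m hm => ?_) ω
  have hm' : ((n : ℝ≥0) + 1) * i ≤ m * i := by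
    gcongr
    exact_mod_cast hm
  calc s + n * i + u < s + n * i + i := by gcongr; exact u.2.2
    _ = s + (n + 1) * i := by ring
    _ ≤ s + m * i := by gcongr
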